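/- Let $\mathbb K$ be $\mathbb R$ or $\mathbb C$, let $X$ be a separable Fréchet space over $\mathbb K$ (that is, a separable, complete, metrizable, locally convex topological vector space), let $T:X\to X$ be a continuous linear operator, and let $0\le a<b\le\infty$. Assume that for all real numbers $\alpha,\beta$ with $a<\alpha<\beta<b$ there exist a dense subset $E$ of $X$ and a map $S:E\to E$ (not assumed linear or continuous; $E$ and $S$ may depend on $\alpha$ and $\beta$) such that for every $x\in E$ $$TSx=x,\qquad \alpha^{-n}T^nx\to 0\quad\text{and}\quad \beta^{n}S^nx\to 0\qquad (n\to\infty).$$ Then the set of vectors $x\in X$ that are hypercyclic for $zT$ for every $z\in\mathbb K$ with $b^{-1}<|z|<a^{-1}$ (where $0^{-1}=\infty$ and $\infty^{-1}=0$), that is, such that $\{(zT)^nx:n=0,1,2,\dots\}$ is dense in $X$ for each such $z$, is a dense $G_\delta$-subset of $X$. -/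

import Mathlib

open Set Filter Topology TopologicalSpace
open scoped ENNReal

/-- The set of universal elements of a family of maps `F i : X → Y`: the points `x` whose
orbit `{F i x}` is dense in `Y`. -/
def universalElements {ι X Y : Type*} [TopologicalSpace Y] (F : ι → X → Y) : Set X :=
  {x | Dense (Set.range fun i => F i x)}

/-- The set of hypercyclic vectors of a continuous linear operator `T`: the universal elements of
the family of its powers `T ^ n`, `n = 0, 1, 2, …`. -/
def hypercyclicVectors {𝕜 X : Type*} [Semiring 𝕜] [TopologicalSpace X] [AddCommMonoid X]
    [Module 𝕜 X] (T : X →L[𝕜] X) : Set X :=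
  universalElements fun (n : ℕ) (x : X) => (T ^ n) x

/-- The set of common hypercyclic vectors of a family of continuous linear operators. -/
def commonHypercyclicVectors {𝕜 X ι : Type*} [Semiring 𝕜] [TopologicalSpace X] [AddCommMonoid X]
    [Module 𝕜 X] (T : ι → X →L[𝕜] X) : Set X :=
  ⋂ i, hypercyclicVectors (T i)

/-! By Baire's theorem it suffices that, for each compact annulus $r_0\le|z|\le r_1$ inside the
parameter range and each basic open $V$, the vectors whose orbit under every such $zT$ meets $V$
form an open dense set. Openness is compactness in $z$.

For density, take $y, v\in E$ with $v\in V$ and perturb $y$ by a finite sum $\sum_k d_k S^{(k+1)N}v$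
with $|d_k|=\rho_k^{-(k+1)N}$. At time $n=(m+1)N$ the term $k=m$ of $z^nT^nx$ is $z^nd_mv$. It is
near $v$ when $|z|^n\approx\rho_m^n$ and the phases match. The other terms are geometrically small
in $|k-m|$, provided $\rho$ grows slowly.

Harmonic increments of $\log\rho$ are slow enough and still sweep $[r_0,r_1]$ (`exists_radii`). The
argument of $z$ is handled on blocks of constant $\rho$ by a finite phase pattern that works for
every rotation (`exists_phases`). `exists_near_forall_exists_pow_near` combines the two. -/

/-! ### Unimodular rotations and universal phase patterns -/

theorem norm_pow_sub_one_le_mul {𝕜 : Type*} [NormedField 𝕜] {w : 𝕜} (hw : ‖w‖ = 1) (l : ℕ) :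
    ‖w ^ l - 1‖ ≤ l * ‖w - 1‖ := by
  induction l with
  | zero => simp
  | succ l ih =>
    have h : w ^ (l + 1) - 1 = w ^ l * (w - 1) + (w ^ l - 1) := by ring
    rw [h]
    refine (norm_add_le _ _).trans ?_
    rw [norm_mul, norm_pow, hw, one_pow]
    push_cast
    linarith

/-- The unit sphere of a proper normed field has finite nets, enumerated by natural numbers. -/
theorem exists_net_unit_sphere (𝕜 : Type*) [NormedField 𝕜] [ProperSpace 𝕜] {ε : ℝ}
    (hε : 0 < ε) :
    ∃ (L : ℕ) (g : ℕ → 𝕜), 0 < L ∧ (∀ l, ‖g l‖ = 1) ∧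
      ∀ u : 𝕜, ‖u‖ = 1 → ∃ l < L, ‖u - g l‖ < ε := by
  obtain ⟨t, hts, htf, htc⟩ := (isCompact_sphere (0 : 𝕜) 1).finite_cover_balls hε
  lift t to Finset 𝕜 using htf
  have hcov : ∀ u : 𝕜, ‖u‖ = 1 → ∃ x ∈ t, ‖u - x‖ < ε := by
    intro u hu
    have := htc (show u ∈ Metric.sphere (0 : 𝕜) 1 by simpa using hu)
    simpa [dist_eq_norm] using this
  refine ⟨t.card, fun l => if h : l < t.card then (t.equivFin.symm ⟨l, h⟩ : 𝕜) else 1,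
    ?_, ?_, ?_⟩
  · obtain ⟨x, hx, -⟩ := hcov 1 norm_one
    exact Finset.card_pos.2 ⟨x, hx⟩
  · intro l
    dsimp only
    split_ifs with h
    · simpa using hts (t.equivFin.symm ⟨l, h⟩).2
    · exact norm_one
  · intro u hu
    obtain ⟨x, hx, hux⟩ := hcov u hu
    refine ⟨t.equivFin ⟨x, hx⟩, (t.equivFin ⟨x, hx⟩).2, ?_⟩
    simpa using hux

/-- Uniform recurrence of rotations: some bounded positive power of a unimodular number is
close to `1`. -/
theorem exists_pow_near_one (𝕜 : Type*) [NormedField 𝕜] [ProperSpace 𝕜] {ε : ℝ} (hε : 0 < ε) :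
    ∃ Q : ℕ, ∀ w : 𝕜, ‖w‖ = 1 → ∃ s, 0 < s ∧ s ≤ Q ∧ ‖w ^ s - 1‖ < ε := by
  obtain ⟨Q, g, -, -, hcov⟩ := exists_net_unit_sphere 𝕜 (half_pos hε)
  refine ⟨Q, fun w hw => ?_⟩
  choose f hf hfw using fun n : ℕ => hcov (w ^ n) (by simp [hw])
  have key : ∀ i j : ℕ, i < j → f i = f j → ‖w ^ (j - i) - 1‖ < ε := by
    intro i j hij h
    have h1 : w ^ j - w ^ i = w ^ i * (w ^ (j - i) - 1) := by
      rw [mul_sub, ← pow_add, Nat.add_sub_cancel' hij.le, mul_one]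
    have h2 : ‖w ^ j - w ^ i‖ < ε := by
      have := norm_sub_le (w ^ j - g (f j)) (w ^ i - g (f j))
      rw [sub_sub_sub_cancel_right] at this
      have h3 := hfw i
      have h4 := hfw j
      rw [h] at h3
      linarith
    simpa [h1, hw] using h2
  -- Pigeonhole: `Q + 1` powers of `w` share `Q` net points.
  obtain ⟨i, hi, j, hj, hne, hfe⟩ := Finset.exists_ne_map_eq_of_card_lt_of_maps_to
    (s := Finset.range (Q + 1)) (t := Finset.range Q) (f := f) (by simp)
    (fun n _ => by simpa using hf n)
  simp only [Finset.mem_range] at hi hj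
  rcases lt_or_gt_of_ne hne with h | h
  · exact ⟨j - i, by omega, by omega, key i j h hfe⟩
  · exact ⟨i - j, by omega, by omega, key j i h hfe.symm⟩

/-- There is a finite sequence of unimodular numbers that comes close to the inverse of every
geometric progression of unimodular numbers. -/
theorem exists_phases (𝕜 : Type*) [NormedField 𝕜] [ProperSpace 𝕜] {δ : ℝ} (hδ : 0 < δ) :
    ∃ (M : ℕ) (c : ℕ → 𝕜), 0 < M ∧ (∀ i, ‖c i‖ = 1) ∧
      ∀ u w : 𝕜, ‖u‖ = 1 → ‖w‖ = 1 → ∃ i < M, ‖u * w ^ i * c i - 1‖ ≤ δ := by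
  obtain ⟨L, g, hL, hg, hcov⟩ := exists_net_unit_sphere 𝕜 (half_pos hδ)
  have hL' : (0 : ℝ) < L := by exact_mod_cast hL
  obtain ⟨Q, hQ⟩ := exists_pow_near_one 𝕜 (ε := δ / 2 / L) (by positivity)
  obtain ⟨s₀, hs₀, hsQ, -⟩ := hQ 1 norm_one
  have hQpos : 0 < Q := hs₀.trans_le hsQ
  set B := Q * L with hB
  have hBpos : 0 < B := Nat.mul_pos hQpos hL
  -- The block of indices with `i / B = s` serves those `w` with `w ^ s` near `1`; in it, index `B *
  -- s + s * l` tries the net point `g l`. Block `0`, where the division by zero returns `0`, is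
  -- never used.
  refine ⟨B * (Q + 1), fun i => (g (i % B / (i / B)))⁻¹, by positivity, by simp [hg], ?_⟩
  intro u w hu hw
  obtain ⟨s, hs, hsQ, hws⟩ := hQ w hw
  -- Moving on by `s * l` steps from `B * s` turns the phase by at most `L * ‖w ^ s - 1‖ ≤ δ / 2`,
  -- so the net point chosen at the start of the block still fits.
  obtain ⟨l, hl, hul⟩ := hcov (u * w ^ (B * s)) (by simp [hu, hw])
  have hsl : s * l < B := by
    calc s * l ≤ Q * l := Nat.mul_le_mul_right _ hsQ
      _ < B := Nat.mul_lt_mul_of_pos_left hl hQpos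
  have h1 : (B * s + s * l) % B = s * l := by
    rw [Nat.mul_add_mod, Nat.mod_eq_of_lt hsl]
  have h2 : (B * s + s * l) / B = s := by
    rw [Nat.mul_add_div hBpos, Nat.div_eq_of_lt hsl, add_zero]
  refine ⟨B * s + s * l, ?_, ?_⟩
  · calc B * s + s * l < B * s + B := by omega
      _ = B * (s + 1) := by ring
      _ ≤ B * (Q + 1) := Nat.mul_le_mul_left _ (by omega)
  · beta_reduce
    rw [h1, h2, Nat.mul_div_cancel_left _ hs]
    have hg0 : g l ≠ 0 := by
      rw [← norm_ne_zero_iff, hg]; exact one_ne_zero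
    have h3 : u * w ^ (B * s + s * l) * (g l)⁻¹ - 1
        = (u * w ^ (B * s) * ((w ^ s) ^ l - 1) + (u * w ^ (B * s) - g l)) * (g l)⁻¹ := by
      field_simp
      ring
    have h4 := norm_pow_sub_one_le_mul (w := w ^ s) (by simp [hw]) l
    have h5 : (l : ℝ) * ‖w ^ s - 1‖ ≤ δ / 2 := by
      calc (l : ℝ) * ‖w ^ s - 1‖ ≤ L * (δ / 2 / L) := by gcongr
        _ = δ / 2 := by field_simp
    rw [h3, norm_mul, norm_inv, hg, inv_one, mul_one]
    refine (norm_add_le _ _).trans ?_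
    rw [norm_mul, norm_mul, norm_pow, hu, hw]
    simp only [one_pow, one_mul]
    linarith

/-! ### Slowly growing radii -/

/-- A slowly increasing sequence of radii, constant on blocks of length `M`, that
covers `[r₀, r₁]` up to the factor `exp δ` at the powers `(k + 1) * N`. -/
theorem exists_radii {r₀ δ : ℝ} (r₁ : ℝ) (hr₀ : 0 < r₀) (hδ : 0 < δ) (hδ1 : δ ≤ 1) {M N : ℕ}
    (hM : 0 < M) (hN : 0 < N) :
    ∃ (ρ : ℕ → ℝ) (B : ℕ), Monotone ρ ∧ (∀ k, r₀ ≤ ρ k) ∧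
      (∀ k j, ρ (k + j) ^ ((k + 1) * N) ≤ Real.exp 1 ^ j * ρ k ^ ((k + 1) * N)) ∧
      ∀ r, r₀ ≤ r → r ≤ r₁ → ∃ b < B, ∀ i < M, ρ (M * b + i) ≤ r ∧
        r ^ ((M * b + i + 1) * N) ≤ Real.exp δ * ρ (M * b + i) ^ ((M * b + i + 1) * N) := by
  have hM' : (0 : ℝ) < M := by exact_mod_cast hM
  have hN' : (0 : ℝ) < N := by exact_mod_cast hN
  set h : ℕ → ℝ := fun b => δ / (M * N) * ∑ i ∈ Finset.range b, 1 / ((i : ℝ) + 1) with hh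
  have hstep : ∀ b, h (b + 1) = h b + δ / (M * N * (b + 1)) := by
    intro b
    simp only [hh, Finset.sum_range_succ]
    field_simp
  have h0 : h 0 = 0 := by simp [hh]
  have hmono : Monotone h := monotone_nat_of_le_succ fun b => by
    rw [hstep]; linarith [show 0 < δ / (M * N * (b + 1)) by positivity]
  have htop : Tendsto h atTop atTop :=
    Real.tendsto_sum_range_one_div_nat_succ_atTop.const_mul_atTop (by positivity)
  have hpos : ∀ b, 0 ≤ h b := fun b => h0 ▸ hmono (Nat.zero_le b)
  -- From block `b` on, each increment of `h`, multiplied by the exponent `(k + 1) * N`, costs at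
  -- most `δ`.
  have hdiff : ∀ k b d : ℕ, k + 1 ≤ M * (b + 1) →
      ((k + 1) * N : ℝ) * h (b + d) ≤ δ * d + ((k + 1) * N : ℝ) * h b := by
    intro k b d hk
    have hk' : (k + 1 : ℝ) ≤ M * (b + 1) := by exact_mod_cast hk
    induction d with
    | zero => simp
    | succ d ih =>
      rw [← add_assoc, hstep]
      have : ((k + 1) * N : ℝ) * (δ / (M * N * ((b + d : ℕ) + 1))) ≤ δ := by
        rw [mul_div_assoc', div_le_iff₀ (by positivity)]
        have h1 : (k + 1 : ℝ) ≤ M * ((b + d : ℕ) + 1) := hk'.trans (by push_cast; gcongr; simp)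
        calc ((k + 1) * N : ℝ) * δ ≤ (M * ((b + d : ℕ) + 1)) * N * δ := by gcongr
          _ = _ := by ring
      push_cast at this ⊢
      linarith
  have hpow : ∀ t : ℝ, ∀ n : ℕ, (r₀ * Real.exp t) ^ n = r₀ ^ n * Real.exp (n * t) := by
    intro t n
    rw [mul_pow, Real.exp_nat_mul]
  have hdivM : ∀ k, k + 1 ≤ M * (k / M + 1) := fun k => by
    have := Nat.lt_mul_div_succ k hM
    omega
  obtain ⟨B, hB⟩ := (htop.eventually_gt_atTop (Real.log (r₁ / r₀))).exists
  clear_value h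
  refine ⟨fun k => r₀ * Real.exp (h (k / M)), B, ?_, ?_, ?_, ?_⟩
  · intro k m hkm
    have := hmono (Nat.div_le_div_right (c := M) hkm)
    dsimp only
    gcongr
  · intro k
    nlinarith [Real.one_le_exp (hpos (k / M))]
  · intro k j
    obtain ⟨d, hd⟩ := Nat.exists_eq_add_of_le (Nat.div_le_div_right (c := M) (Nat.le_add_right k j))
    have hdj : d ≤ j := by
      have : (k + j) / M ≤ k / M + j := by
        rw [Nat.div_le_iff_le_mul_add_pred hM]
        have h1 := hdivM k
        have h2 : j ≤ M * j := Nat.le_mul_of_pos_left _ hM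
        have h3 : M * (k / M + j) = M * (k / M) + M * j := by ring
        have h4 : M * (k / M + 1) = M * (k / M) + M := by ring
        omega
      omega
    have h1 := hdiff k (k / M) d (hdivM k)
    have hdj' : (d : ℝ) ≤ j := by exact_mod_cast hdj
    beta_reduce
    rw [hpow, hpow, hd, ← Real.exp_nat_mul, mul_left_comm, ← Real.exp_add]
    gcongr
    push_cast
    nlinarith [show (0 : ℝ) ≤ d by positivity]
  · intro r hr hr'
    have hrpos : 0 < r := hr₀.trans_le hr
    set t := Real.log (r / r₀) with ht
    have hrt : r = r₀ * Real.exp t := by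
      rw [ht, Real.exp_log (by positivity)]; field_simp
    have ht0 : 0 ≤ t := Real.log_nonneg ((one_le_div hr₀).2 hr)
    have htB : t < h B := lt_of_le_of_lt
      (Real.log_le_log (by positivity) (by gcongr)) hB
    classical
    have hex : ∃ b, t < h b := ⟨B, htB⟩
    -- The block wanted is the one just before `h` first exceeds `t`.
    set b' := Nat.find hex with hb'
    have hb'pos : b' ≠ 0 := by
      intro h'
      have := Nat.find_spec hex
      rw [← hb', h', h0] at this
      linarith
    obtain ⟨b, hb⟩ := Nat.exists_eq_succ_of_ne_zero hb'pos
    have hb1 : h b ≤ t := not_lt.1 (Nat.find_min hex (by omega))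
    have hb2 : t < h (b + 1) := by
      have := Nat.find_spec hex
      rwa [← hb', hb] at this
    have hbB : b < B := by
      have : b' ≤ B := Nat.find_min' hex htB
      omega
    refine ⟨b, hbB, fun i hi => ?_⟩
    have hdiv : (M * b + i) / M = b := by
      rw [Nat.mul_add_div hM, Nat.div_eq_of_lt hi, add_zero]
    beta_reduce
    rw [hdiv]
    refine ⟨?_, ?_⟩
    · rw [hrt]; gcongr
    · rw [hrt, hpow, hpow, mul_left_comm, ← Real.exp_add]
      have h1 := hdiff (M * b + i) b 1 (by rw [mul_add]; omega)
      gcongr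
      push_cast at h1 ⊢
      have h2 : ((M * b + i + 1) * N : ℝ) * t ≤ ((M * b + i + 1) * N : ℝ) * h (b + 1) := by
        gcongr
      linarith

/-! ### Construction of the perturbed vector -/

theorem sum_pow_succ_le_two_mul {Q : ℝ} (hQ0 : 0 ≤ Q) (hQ : Q ≤ 1 / 2) (n : ℕ) :
    ∑ j ∈ Finset.range n, Q ^ (j + 1) ≤ 2 * Q := by
  suffices h : ∑ j ∈ Finset.range n, Q ^ (j + 1) ≤ 2 * Q - 2 * Q ^ (n + 1) by
    linarith [pow_nonneg hQ0 (n + 1)]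
  induction n with
  | zero => simp
  | succ n ih =>
    rw [Finset.sum_range_succ, pow_succ Q (n + 1)]
    have := mul_le_mul_of_nonneg_left hQ (pow_nonneg hQ0 (n + 1))
    linarith

theorem Seminorm.map_sum_le_sum {𝕜 X ι : Type*} [SeminormedRing 𝕜] [AddCommGroup X] [Module 𝕜 X]
    (p : Seminorm 𝕜 X) (t : Finset ι) (f : ι → X) {g : ι → ℝ} (h : ∀ i ∈ t, p (f i) ≤ g i) :
    p (∑ i ∈ t, f i) ≤ ∑ i ∈ t, g i :=
  (Finset.le_sum_of_subadditive p (map_zero p).le (map_add_le_add p) t f).trans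
    (Finset.sum_le_sum h)

theorem pow_apply_add_backward_orbit {R X : Type*} [Semiring R] [AddCommMonoid X] [Module R X]
    {T : X →ₗ[R] X} {s : ℕ → X} (hs : ∀ n, T (s (n + 1)) = s n) (m n : ℕ) :
    (T ^ m) (s (m + n)) = s n := by
  induction m with
  | zero => simp
  | succ m ih =>
    rw [pow_succ, Module.End.mul_apply, show m + 1 + n = m + n + 1 by ring, hs, ih]

/-- Given a forward orbit of `y` and a bilateral orbit of `v` of controlled growth, there is a
vector close to `y` some point of whose orbit under `z • T` is close to `v`, for every `z` in a
closed annulus. -/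
theorem exists_near_forall_exists_pow_near {𝕜 X : Type*} [RCLike 𝕜] [AddCommGroup X] [Module 𝕜 X]
    (p : Seminorm 𝕜 X) (T : X →ₗ[𝕜] X) (y v : X) (s : ℕ → X) (hs0 : s 0 = v)
    (hs : ∀ n, T (s (n + 1)) = s n) {A q r₀ r₁ : ℝ} (hA : 0 < A) (hq0 : 0 < q) (hq1 : q < 1)
    (hr₀ : 0 < r₀) (hr₁ : 0 < r₁)
    (hy : ∀ n, p ((T ^ n) y) ≤ A * (q / r₁) ^ n) (hv : ∀ n, p ((T ^ n) v) ≤ A * (q / r₁) ^ n)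
    (hsb : ∀ n, p (s n) ≤ A * (q * r₀) ^ n) :
    ∃ x, p (x - y) < 1 ∧
      ∀ z : 𝕜, r₀ ≤ ‖z‖ → ‖z‖ ≤ r₁ → ∃ n : ℕ, p (z ^ n • (T ^ n) x - v) < 1 := by
  obtain ⟨δ, hδ, hδ1, hδA⟩ : ∃ δ : ℝ, 0 < δ ∧ δ ≤ 1 ∧ 6 * δ * A ≤ 1 :=
    -- The diagonal error `3 * δ * A` gets half of the allowance; all other terms get the other half
    -- through the choice of `N`.
    ⟨min 1 (1 / (6 * A)), by positivity, min_le_left _ _, by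
      have := mul_le_mul_of_nonneg_right (min_le_right 1 (1 / (6 * A))) (by positivity : 0 ≤ 6 * A)
      rw [one_div_mul_cancel (by positivity)] at this
      linarith⟩
  obtain ⟨M, c, hM, hc, hcov⟩ := exists_phases 𝕜 hδ
  set e := Real.exp 1 with he
  have he1 : 1 ≤ e := Real.one_le_exp zero_le_one
  -- The growth of `ρ` may cost a factor `e` per index; spacing the times by `N` makes the decay `q
  -- ^ N` absorb it.
  obtain ⟨N, hN, hQ1, hQ2⟩ : ∃ N : ℕ, 0 < N ∧ e * q ^ N ≤ 1 / 2 ∧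
      (A + 4 * (A * e)) * (e * q ^ N) < 1 / 2 := by
    have h0 : Tendsto (fun N => e * q ^ N) atTop (𝓝 0) := by
      simpa using (tendsto_pow_atTop_nhds_zero_of_lt_one hq0.le hq1).const_mul e
    have h1 : Tendsto (fun N => (A + 4 * (A * e)) * (e * q ^ N)) atTop (𝓝 0) := by
      simpa using h0.const_mul (A + 4 * (A * e))
    exact ((eventually_gt_atTop 0).and ((h0.eventually_le_const (by norm_num)).and
      (h1.eventually_lt_const (by norm_num)))).exists
  set Q := e * q ^ N with hQ
  have hQ0 : 0 < Q := by positivity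
  have hqQ : q ^ N ≤ Q := le_mul_of_one_le_left (by positivity) he1
  have hqQ' : ∀ j, q ^ (j * N) ≤ Q ^ j := fun j => by
    rw [mul_comm, pow_mul]; gcongr
  obtain ⟨ρ, B, hρm, hρ0, hρs, hρcov⟩ := exists_radii r₁ hr₀ hδ hδ1 hM hN
  have hρpos : ∀ k, 0 < ρ k := fun k => hr₀.trans_le (hρ0 k)
  set d : ℕ → 𝕜 := fun k => c (k % M) * ((((ρ k) ^ ((k + 1) * N))⁻¹ : ℝ) : 𝕜) with hd
  have hdn : ∀ k, ‖d k‖ = ((ρ k) ^ ((k + 1) * N))⁻¹ := by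
    intro k
    rw [hd]
    simp only [norm_mul, hc, one_mul, RCLike.norm_ofReal]
    exact abs_of_pos (by have := hρpos k; positivity)
  set x₀ := ∑ k ∈ Finset.range (M * B), d k • s ((k + 1) * N) with hx₀
  refine ⟨y + x₀, ?_, ?_⟩
  · rw [add_sub_cancel_left]
    have h1 : p x₀ ≤ ∑ k ∈ Finset.range (M * B), A * Q ^ (k + 1) := by
      refine p.map_sum_le_sum _ _ fun k _ => ?_
      rw [map_smul_eq_mul, hdn]
      calc ((ρ k) ^ ((k + 1) * N))⁻¹ * p (s ((k + 1) * N))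
          ≤ (r₀ ^ ((k + 1) * N))⁻¹ * (A * (q * r₀) ^ ((k + 1) * N)) := by
            gcongr
            · exact hρ0 k
            · exact hsb _
        _ = A * q ^ ((k + 1) * N) := by
            rw [mul_pow]; field_simp
        _ ≤ A * Q ^ (k + 1) := by gcongr; exact hqQ' _
    rw [← Finset.mul_sum] at h1
    have h2 := sum_pow_succ_le_two_mul hQ0.le hQ1 (M * B)
    nlinarith [mul_pos (mul_pos hA (by positivity : 0 < e)) hQ0, mul_pos hA hQ0,
      mul_le_mul_of_nonneg_left h2 hA.le, mul_le_mul_of_nonneg_left he1 (mul_pos hA hQ0).le]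
  · intro z hz₀ hz₁
    have hzpos : 0 < ‖z‖ := hr₀.trans_le hz₀
    obtain ⟨b, hb, hρb⟩ := hρcov ‖z‖ hz₀ hz₁
    set w : 𝕜 := z * ((‖z‖⁻¹ : ℝ) : 𝕜) with hw
    have hwn : ‖w‖ = 1 := by
      rw [hw, norm_mul, RCLike.norm_ofReal, abs_of_pos (by positivity)]
      field_simp
    -- Polar decomposition, valid over both fields.
    have hzw : z = ((‖z‖ : ℝ) : 𝕜) * w := by
      have : ((‖z‖ : ℝ) : 𝕜) ≠ 0 := by exact_mod_cast hzpos.ne'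
      rw [hw]; push_cast; field_simp
    obtain ⟨i, hi, hphase⟩ := hcov (w ^ ((M * b + 1) * N)) (w ^ N) (by simp [hwn]) (by simp [hwn])
    obtain ⟨hρz, hzρ⟩ := hρb i hi
    set m := M * b + i with hm
    have hmM : m % M = i := by rw [hm, Nat.mul_add_mod, Nat.mod_eq_of_lt hi]
    have hphase' : ‖w ^ ((m + 1) * N) * c (m % M) - 1‖ ≤ δ := by
      rw [hmM]
      convert hphase using 4
      rw [← pow_mul, ← pow_add, hm]
      congr 1
      ring
    have hzρ1 : ‖z‖ ^ ((m + 1) * N) ≤ e * ρ m ^ ((m + 1) * N) :=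
      hzρ.trans (by gcongr ?_ * _; exacts [pow_nonneg (hρpos m).le _, Real.exp_le_exp.2 hδ1])
    -- the diagonal coefficient
    have hdiag : ‖z ^ ((m + 1) * N) * d m - 1‖ ≤ 3 * δ := by
      set τ : ℝ := ‖z‖ ^ ((m + 1) * N) * (ρ m ^ ((m + 1) * N))⁻¹ with hτ
      have hρp : 0 < ρ m ^ ((m + 1) * N) := pow_pos (hρpos m) _
      have hτ1 : 1 ≤ τ := by
        rw [hτ, ← div_eq_mul_inv, one_le_div hρp]
        exact pow_le_pow_left₀ (hρpos m).le hρz _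
      have hτ2 : τ ≤ Real.exp δ := by
        rw [hτ, ← div_eq_mul_inv, div_le_iff₀ hρp]
        exact hzρ
      have hexp : Real.exp δ - 1 ≤ 2 * δ := by
        have := Real.abs_exp_sub_one_le (x := δ) (by rwa [abs_of_pos hδ])
        rw [abs_of_pos hδ] at this
        exact (le_abs_self _).trans this
      set ω := w ^ ((m + 1) * N) * c (m % M) with hω
      have hωn : ‖ω‖ = 1 := by rw [hω, norm_mul, norm_pow, hwn, hc]; simp
      have h1 : z ^ ((m + 1) * N) * d m - 1 = ((τ - 1 : ℝ) : 𝕜) * ω + (ω - 1) := by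
        have : z ^ ((m + 1) * N) = ((‖z‖ ^ ((m + 1) * N) : ℝ) : 𝕜) * w ^ ((m + 1) * N) := by
          conv_lhs => rw [hzw, mul_pow]
          push_cast
          rfl
        rw [this, hd, hω, hτ]
        push_cast
        ring
      rw [h1]
      refine (norm_add_le _ _).trans ?_
      rw [norm_mul, hωn, RCLike.norm_ofReal, abs_of_nonneg (by linarith)]
      linarith
    have hmB : m < M * B := by
      calc m < M * b + M := by omega
        _ = M * (b + 1) := by ring
        _ ≤ M * B := Nat.mul_le_mul_left _ hb
    obtain ⟨K, hK⟩ := Nat.exists_eq_add_of_le (Nat.succ_le_of_lt hmB)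
    -- terms before and after the diagonal
    have hup : ∀ j, p ((z ^ ((m + 1) * N) * d (m + 1 + j)) •
        (T ^ ((m + 1) * N)) (s ((m + 1 + j + 1) * N))) ≤ A * e * Q ^ (j + 1) := by
      intro j
      have h1 : (m + 1 + j + 1) * N = (m + 1) * N + (j + 1) * N := by ring
      have hk := hρpos (m + 1 + j)
      rw [map_smul_eq_mul, norm_mul, norm_pow, hdn, h1, pow_apply_add_backward_orbit hs, pow_add]
      have h2 : ‖z‖ ^ ((m + 1) * N) ≤ e * ρ (m + 1 + j) ^ ((m + 1) * N) :=
        hzρ1.trans (by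
          gcongr
          · exact (hρpos m).le
          · exact hρm (by omega))
      calc ‖z‖ ^ ((m + 1) * N) *
            (ρ (m + 1 + j) ^ ((m + 1) * N) * ρ (m + 1 + j) ^ ((j + 1) * N))⁻¹ *
            p (s ((j + 1) * N))
          ≤ (e * ρ (m + 1 + j) ^ ((m + 1) * N)) *
            (ρ (m + 1 + j) ^ ((m + 1) * N) * r₀ ^ ((j + 1) * N))⁻¹ *
            (A * (q * r₀) ^ ((j + 1) * N)) := by
              gcongr
              · exact hρ0 _
              · exact hsb _
        _ = A * e * q ^ ((j + 1) * N) := by rw [mul_pow]; field_simp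
        _ ≤ A * e * Q ^ (j + 1) := by gcongr; exact hqQ' _
    have hdown : ∀ k j, k + (j + 1) = m → p ((z ^ ((m + 1) * N) * d k) •
        (T ^ ((m + 1) * N)) (s ((k + 1) * N))) ≤ A * e * Q ^ (j + 1) := by
      intro k j hkj
      have h1 : (m + 1) * N = (j + 1) * N + (k + 1) * N := by rw [← hkj]; ring
      have h2 : (T ^ ((m + 1) * N)) (s ((k + 1) * N)) = (T ^ ((j + 1) * N)) v := by
        rw [h1, pow_add, Module.End.mul_apply]
        have := pow_apply_add_backward_orbit hs ((k + 1) * N) 0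
        rw [add_zero] at this
        rw [this, hs0]
      have hk := hρpos k
      have hmp := hρpos m
      -- One factor `e` compares `‖z‖` with `ρ m`; the factor `e ^ (j + 1)` compares `ρ m` with `ρ
      -- k`. The remaining power of `‖z‖` is beaten by the decay of the forward orbit of `v`.
      have h3 : ‖z‖ ^ ((k + 1) * N) ≤ e * (e ^ (j + 1) * ρ k ^ ((k + 1) * N)) := by
        have h4 : ‖z‖ ^ ((k + 1) * N) ≤ e * ρ m ^ ((k + 1) * N) := by
          rw [← div_le_iff₀ (by positivity), ← div_pow] at hzρ1 ⊢
          refine le_trans (pow_le_pow_right₀ ((one_le_div hmp).2 hρz) ?_) hzρ1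
          exact Nat.mul_le_mul_right _ (by omega)
        refine h4.trans ?_
        gcongr
        rw [← hkj]
        exact hρs k (j + 1)
      rw [map_smul_eq_mul, norm_mul, norm_pow, hdn, h2, h1, pow_add]
      calc ‖z‖ ^ ((j + 1) * N) * ‖z‖ ^ ((k + 1) * N) * (ρ k ^ ((k + 1) * N))⁻¹ *
            p ((T ^ ((j + 1) * N)) v)
          ≤ r₁ ^ ((j + 1) * N) * (e * (e ^ (j + 1) * ρ k ^ ((k + 1) * N))) *
            (ρ k ^ ((k + 1) * N))⁻¹ * (A * (q / r₁) ^ ((j + 1) * N)) := by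
              gcongr
              exact hv _
        _ = A * e * (e ^ (j + 1) * q ^ ((j + 1) * N)) := by rw [div_pow]; field_simp
        _ = A * e * Q ^ (j + 1) := by rw [hQ, mul_pow, mul_comm (j + 1) N, pow_mul]
    refine ⟨(m + 1) * N, ?_⟩
    set F : ℕ → X := fun k => (z ^ ((m + 1) * N) * d k) •
        (T ^ ((m + 1) * N)) (s ((k + 1) * N)) with hF
    have hFm : F m = (z ^ ((m + 1) * N) * d m) • v := by
      have := pow_apply_add_backward_orbit hs ((m + 1) * N) 0
      rw [add_zero, hs0] at this
      rw [hF]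
      simp only [this]
    -- The lower sum is reversed so that `j + 1` is the distance to the diagonal on both sides.
    have hsplit : z ^ ((m + 1) * N) • (T ^ ((m + 1) * N)) (y + x₀) - v =
        z ^ ((m + 1) * N) • (T ^ ((m + 1) * N)) y +
        (∑ j ∈ Finset.range m, F (m - 1 - j) + (z ^ ((m + 1) * N) * d m - 1) • v +
          ∑ j ∈ Finset.range K, F (m + 1 + j)) := by
      have h1 : z ^ ((m + 1) * N) • (T ^ ((m + 1) * N)) x₀ = ∑ k ∈ Finset.range (M * B), F k := by
        rw [hx₀, map_sum, Finset.smul_sum]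
        refine Finset.sum_congr rfl fun k _ => ?_
        rw [map_smul, smul_smul]
      rw [map_add, smul_add, h1, hK, Finset.sum_range_add, Finset.sum_range_succ, hFm,
        Finset.sum_range_reflect, sub_smul, one_smul]
      abel
    rw [hsplit]
    have hb1 : p (z ^ ((m + 1) * N) • (T ^ ((m + 1) * N)) y) ≤ A * Q := by
      rw [map_smul_eq_mul, norm_pow]
      calc ‖z‖ ^ ((m + 1) * N) * p ((T ^ ((m + 1) * N)) y)
          ≤ r₁ ^ ((m + 1) * N) * (A * (q / r₁) ^ ((m + 1) * N)) := by gcongr; exact hy _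
        _ = A * q ^ ((m + 1) * N) := by rw [div_pow]; field_simp
        _ ≤ A * q ^ N := by
            gcongr A * ?_
            exact pow_le_pow_of_le_one hq0.le hq1.le (Nat.le_mul_of_pos_left _ (by omega))
        _ ≤ A * Q := by gcongr
    have hb2 : p (∑ j ∈ Finset.range m, F (m - 1 - j)) ≤ A * e * (2 * Q) := by
      refine (p.map_sum_le_sum _ _ (g := fun j => A * e * Q ^ (j + 1)) fun j hj => ?_).trans ?_
      · have := Finset.mem_range.1 hj
        exact hdown _ _ (by omega)
      · rw [← Finset.mul_sum]
        gcongr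
        exact sum_pow_succ_le_two_mul hQ0.le hQ1 m
    have hb3 : p (∑ j ∈ Finset.range K, F (m + 1 + j)) ≤ A * e * (2 * Q) := by
      refine (p.map_sum_le_sum _ _ (g := fun j => A * e * Q ^ (j + 1)) fun j _ => hup j).trans ?_
      rw [← Finset.mul_sum]
      gcongr
      exact sum_pow_succ_le_two_mul hQ0.le hQ1 K
    have hb4 : p ((z ^ ((m + 1) * N) * d m - 1) • v) ≤ 3 * δ * A := by
      rw [map_smul_eq_mul]
      have : p v ≤ A := by simpa using hv 0
      gcongr
    have t1 := map_add_le_add p (z ^ ((m + 1) * N) • (T ^ ((m + 1) * N)) y)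
      (∑ j ∈ Finset.range m, F (m - 1 - j) + (z ^ ((m + 1) * N) * d m - 1) • v +
          ∑ j ∈ Finset.range K, F (m + 1 + j))
    have t2 := map_add_le_add p
      (∑ j ∈ Finset.range m, F (m - 1 - j) + (z ^ ((m + 1) * N) * d m - 1) • v)
      (∑ j ∈ Finset.range K, F (m + 1 + j))
    have t3 := map_add_le_add p (∑ j ∈ Finset.range m, F (m - 1 - j))
      ((z ^ ((m + 1) * N) * d m - 1) • v)
    linarith

/-! ### Seminorms, density and the Baire argument -/

/-- A real locally convex topology on a vector space over `ℝ` or `ℂ` is generated by seminorms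
over that field. -/
theorem exists_continuous_seminorm_ball_subset (𝕜 : Type*) {X : Type*} [RCLike 𝕜] [AddCommGroup X]
    [Module 𝕜 X] [Module ℝ X] [IsScalarTower ℝ 𝕜 X] [TopologicalSpace X] [IsTopologicalAddGroup X]
    [ContinuousSMul 𝕜 X] [LocallyConvexSpace ℝ X] {W : Set X} (hW : W ∈ 𝓝 (0 : X)) :
    ∃ p : Seminorm 𝕜 X, Continuous p ∧ ∀ x, p x < 1 → x ∈ W := by
  open scoped ComplexOrder in
  have : LocallyConvexSpace 𝕜 X := by
    rw [locallyConvexSpace_iff_zero]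
    simp only [convex_RCLike_iff_convex_real]
    exact LocallyConvexSpace.convex_basis_zero ℝ X
  have : ContinuousSMul ℝ X := IsScalarTower.continuousSMul 𝕜
  have hp := PolynormableSpace.withSeminorms 𝕜 X
  obtain ⟨t, r, hr, hsub⟩ := (hp.mem_nhds_iff 0 W).1 hW
  refine ⟨r⁻¹.toNNReal • t.sup fun q => q.1,
    (Seminorm.continuous_finsetSup fun q _ => q.2).const_smul _, fun x hx => hsub ?_⟩
  rw [Seminorm.mem_ball, sub_zero]
  rw [smul_apply] at hx
  rw [NNReal.smul_def, Real.coe_toNNReal _ (inv_nonneg.2 hr.le), smul_eq_mul] at hx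
  rwa [inv_mul_lt_iff₀ hr, mul_one] at hx

theorem Seminorm.map_real_smul_eq_mul {𝕜 X : Type*} [RCLike 𝕜] [AddCommGroup X] [Module 𝕜 X]
    [Module ℝ X] [IsScalarTower ℝ 𝕜 X] (p : Seminorm 𝕜 X) (r : ℝ) (x : X) :
    p (r • x) = |r| * p x := by
  rw [← algebraMap_smul 𝕜 r x, map_smul_eq_mul, norm_algebraMap']
  rfl

/-- The vectors whose orbit under `z • T` meets `V` for every `z` in a compact set form an
open set. -/
theorem isOpen_setOf_forall_exists_smul_pow_mem {𝕜 X : Type*} [NormedField 𝕜] [AddCommGroup X]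
    [Module 𝕜 X] [TopologicalSpace X] [ContinuousSMul 𝕜 X]
    (T : X →L[𝕜] X) {K : Set 𝕜} (hK : IsCompact K) {V : Set X} (hV : IsOpen V) :
    IsOpen {x : X | ∀ z ∈ K, ∃ n : ℕ, z ^ n • (T ^ n) x ∈ V} := by
  rw [isOpen_iff_eventually]
  intro x hx
  refine hK.eventually_forall_of_forall_eventually fun z hz => ?_
  obtain ⟨n, hn⟩ := hx z hz
  have hc : Continuous fun w : X × 𝕜 => w.2 ^ n • (T ^ n) w.1 := by fun_prop
  filter_upwards [hc.continuousAt.eventually_mem (hV.mem_nhds hn)] with w hw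
  exact ⟨n, hw⟩

/-- `S` enters only through the single backward orbit of one vector `v`, so neither linearity nor
continuity of `S` matters. -/
theorem dense_setOf_forall_exists_smul_pow_mem {𝕜 X : Type*} [RCLike 𝕜] [AddCommGroup X]
    [Module 𝕜 X] [Module ℝ X] [IsScalarTower ℝ 𝕜 X] [TopologicalSpace X] [IsTopologicalAddGroup X]
    [ContinuousSMul 𝕜 X] [LocallyConvexSpace ℝ X] (T : X →L[𝕜] X) {α β r₀ r₁ : ℝ}
    (hα : 0 < α) (hr₀ : 0 < r₀) (hr₁ : 0 < r₁) (hβ : 0 < β) (hαr : α * r₁ < 1) (hβr : 1 < β * r₀)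
    (E : Set X) (hE : Dense E) (S : E → E) (hTS : ∀ x : E, T (S x : X) = (x : X))
    (hT : ∀ x : E, Tendsto (fun n : ℕ => (α ^ n)⁻¹ • (T ^ n) (x : X)) atTop (𝓝 0))
    (hS : ∀ x : E, Tendsto (fun n : ℕ => β ^ n • ((S^[n] x : E) : X)) atTop (𝓝 0))
    {V : Set X} (hV : IsOpen V) (hVne : V.Nonempty) :
    Dense {x : X | ∀ z : 𝕜, r₀ ≤ ‖z‖ → ‖z‖ ≤ r₁ → ∃ n : ℕ, z ^ n • (T ^ n) x ∈ V} := by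
  rw [dense_iff_inter_open]
  intro U hU hUne
  obtain ⟨y, hyU, hyE⟩ := hE.inter_open_nonempty U hU hUne
  obtain ⟨v, hvV, hvE⟩ := hE.inter_open_nonempty V hV hVne
  have hW : {x : X | x + y ∈ U} ∩ {x : X | x + v ∈ V} ∈ 𝓝 (0 : X) := by
    refine inter_mem ?_ ?_
    · exact (hU.preimage (continuous_add_const y)).mem_nhds (by simpa using hyU)
    · exact (hV.preimage (continuous_add_const v)).mem_nhds (by simpa using hvV)
  obtain ⟨p, hp, hpW⟩ := exists_continuous_seminorm_ball_subset 𝕜 hW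
  have hbdd : ∀ f : ℕ → X, Tendsto f atTop (𝓝 0) → ∃ A, ∀ n, p (f n) ≤ A := by
    intro f hf
    obtain ⟨A, hA⟩ := ((hp.tendsto 0).comp hf).bddAbove_range
    exact ⟨A, fun n => hA ⟨n, rfl⟩⟩
  obtain ⟨A₁, hA₁⟩ := hbdd _ (hT ⟨y, hyE⟩)
  obtain ⟨A₂, hA₂⟩ := hbdd _ (hT ⟨v, hvE⟩)
  obtain ⟨A₃, hA₃⟩ := hbdd _ (hS ⟨v, hvE⟩)
  simp only [Seminorm.map_real_smul_eq_mul, abs_of_pos (pow_pos hβ _),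
    abs_of_pos (inv_pos.2 (pow_pos hα _))] at hA₁ hA₂ hA₃
  set A := max 1 (max A₁ (max A₂ A₃)) with hA
  have hA0 : 0 < A := lt_max_of_lt_left one_pos
  have hA1 : A₁ ≤ A := by simp [hA]
  have hA2 : A₂ ≤ A := by simp [hA]
  have hA3 : A₃ ≤ A := by simp [hA]
  -- One ratio below `1` serves both the forward rate `α ≤ q / r₁` and the backward rate `β⁻¹ ≤ q *
  -- r₀`.
  set q := max (α * r₁) (β * r₀)⁻¹ with hq
  have hq0 : 0 < q := lt_max_of_lt_left (by positivity)
  have hαq : α ≤ q / r₁ := (le_div_iff₀ hr₁).2 (le_max_left _ _)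
  have hβq : β⁻¹ ≤ q * r₀ := by
    rw [← div_le_iff₀ hr₀, div_eq_mul_inv, ← mul_inv]
    exact le_max_right _ _
  obtain ⟨x, hxy, hx⟩ := exists_near_forall_exists_pow_near p (T : X →ₗ[𝕜] X) y v
    (fun n => ((S^[n] ⟨v, hvE⟩ : E) : X)) rfl
    (fun n => by
      rw [Function.iterate_succ_apply']
      exact hTS _) hA0 hq0 (max_lt hαr (inv_lt_one_of_one_lt₀ hβr)) hr₀ hr₁
    (fun n => by
      have := (inv_mul_le_iff₀ (pow_pos hα n)).1 (hA₁ n)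
      rw [← ContinuousLinearMap.toLinearMap_pow]
      refine this.trans ?_
      rw [mul_comm]
      gcongr)
    (fun n => by
      have := (inv_mul_le_iff₀ (pow_pos hα n)).1 (hA₂ n)
      rw [← ContinuousLinearMap.toLinearMap_pow]
      refine this.trans ?_
      rw [mul_comm]
      gcongr)
    (fun n => by
      have := (le_div_iff₀' (pow_pos hβ n)).2 (hA₃ n)
      refine this.trans ?_
      rw [div_eq_mul_inv, ← inv_pow]
      gcongr)
  refine ⟨x, by simpa using (hpW _ hxy).1, fun z hz₀ hz₁ => ?_⟩
  obtain ⟨n, hn⟩ := hx z hz₀ hz₁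
  rw [← ContinuousLinearMap.toLinearMap_pow] at hn
  have hmem := (hpW _ hn).2
  rw [mem_ofPred_eq, sub_add_cancel] at hmem
  exact ⟨n, hmem⟩

/-- Common hypercyclicity, expressed through a countable exhaustion of the parameter set and a
countable basis of the topology. -/
theorem commonHypercyclicVectors_eq_iInter {𝕜 X ι : Type*} [RCLike 𝕜] [AddCommGroup X]
    [Module 𝕜 X] [TopologicalSpace X] [IsTopologicalAddGroup X] [ContinuousConstSMul 𝕜 X]
    (T : X →L[𝕜] X) {Z : Set 𝕜}
    {K : ι → Set 𝕜} (hK : ⋃ i, K i = Z) {B : Set (Set X)} (hB : IsTopologicalBasis B)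
    (hBne : ∅ ∉ B) :
    commonHypercyclicVectors (fun z : Z => (z : 𝕜) • T) =
      ⋂ j : ι × B, {x : X | ∀ z ∈ K j.1, ∃ n : ℕ, z ^ n • (T ^ n) x ∈ (j.2 : Set X)} := by
  ext x
  simp only [commonHypercyclicVectors, hypercyclicVectors, universalElements, mem_iInter,
    mem_ofPred_eq, hB.dense_iff, Prod.forall, Subtype.forall, smul_pow,
    smul_apply]
  constructor
  · intro h i V hV z hz
    obtain ⟨w, hwV, n, rfl⟩ := h z (hK ▸ mem_iUnion.2 ⟨i, hz⟩) V hV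
      (nonempty_iff_ne_empty.2 fun h0 => hBne (h0 ▸ hV))
    exact ⟨n, hwV⟩
  · intro h z hz V hV _
    obtain ⟨i, hi⟩ := mem_iUnion.1 (hK ▸ hz)
    obtain ⟨n, hn⟩ := h i V hV z hi
    exact ⟨_, hn, n, rfl⟩

/-- Rational radii make the exhaustion countable, as Baire's theorem requires; `0 < i.1` keeps the
annuli away from `0`. -/
theorem iUnion_rat_annulus_eq (𝕜 : Type*) [RCLike 𝕜] (l u : ℝ≥0∞) :
    ⋃ i : {i : ℚ × ℚ // 0 < i.1 ∧ i.1 ≤ i.2 ∧ l < ENNReal.ofReal i.1 ∧ ENNReal.ofReal i.2 < u},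
      {z : 𝕜 | (i.1.1 : ℝ) ≤ ‖z‖ ∧ ‖z‖ ≤ i.1.2} = {z : 𝕜 | l < ‖z‖ₑ ∧ ‖z‖ₑ < u} := by
  ext z
  simp only [mem_iUnion, mem_ofPred_eq, ← ofReal_norm]
  constructor
  · rintro ⟨⟨⟨r₀, r₁⟩, h0, h1, hl, hu⟩, hz₀, hz₁⟩
    exact ⟨hl.trans_le (ENNReal.ofReal_le_ofReal hz₀),
      (ENNReal.ofReal_le_ofReal hz₁).trans_lt hu⟩
  · rintro ⟨hl, hu⟩
    obtain ⟨r₀, hr₀, hlr, hrz⟩ := ENNReal.lt_iff_exists_rat_btwn.1 hl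
    obtain ⟨r₁, hr₁, hzr, hru⟩ := ENNReal.lt_iff_exists_rat_btwn.1 hu
    have h0 : (0 : ℝ) < r₀ := ENNReal.ofReal_pos.1 (zero_le.trans_lt hlr)
    have h1 : (r₀ : ℝ) < ‖z‖ := (ENNReal.ofReal_lt_ofReal_iff_of_nonneg h0.le).1 hrz
    have h2 : ‖z‖ < r₁ := (ENNReal.ofReal_lt_ofReal_iff_of_nonneg (norm_nonneg z)).1 hzr
    exact ⟨⟨(r₀, r₁), by exact_mod_cast h0, by exact_mod_cast (h1.trans h2).le, hlr, hru⟩,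
      h1.le, h2.le⟩

theorem mainTheorem9 {𝕜 X : Type*} [RCLike 𝕜]
    -- `X` is a separable Fréchet space over `𝕜` (`ℝ` or `ℂ`)
    [AddCommGroup X] [Module 𝕜 X] [Module ℝ X] [IsScalarTower ℝ 𝕜 X]
    [UniformSpace X] [IsUniformAddGroup X] [ContinuousSMul 𝕜 X] [LocallyConvexSpace ℝ X]
    [MetrizableSpace X] [CompleteSpace X] [SeparableSpace X]
    (T : X →L[𝕜] X) (a b : ℝ≥0∞) (hab : a < b)
    (hT : ∀ α β : ℝ, a < ENNReal.ofReal α → α < β → ENNReal.ofReal β < b →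
      ∃ E : Set X, Dense E ∧ ∃ S : E → E, ∀ x : E,
        T (S x : X) = (x : X) ∧
        Tendsto (fun n : ℕ => (α ^ n)⁻¹ • (T ^ n) (x : X)) atTop (𝓝 0) ∧
        Tendsto (fun n : ℕ => β ^ n • ((S^[n] x : E) : X)) atTop (𝓝 0)) :
    Dense (commonHypercyclicVectors
      fun z : {z : 𝕜 // b⁻¹ < ‖z‖ₑ ∧ ‖z‖ₑ < a⁻¹} => (z : 𝕜) • T) ∧
    IsGδ (commonHypercyclicVectors
      fun z : {z : 𝕜 // b⁻¹ < ‖z‖ₑ ∧ ‖z‖ₑ < a⁻¹} => (z : 𝕜) • T) := by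
  have : (uniformity X).IsCountablyGenerated := IsUniformAddGroup.uniformity_countably_generated
  have : SecondCountableTopology X := UniformSpace.secondCountable_of_separable X
  have hcount : Countable (countableBasis X) := (countable_countableBasis X).to_subtype
  have heq := commonHypercyclicVectors_eq_iInter T (iUnion_rat_annulus_eq 𝕜 b⁻¹ a⁻¹)
    (isBasis_countableBasis X) (empty_notMem_countableBasis X)
  have hopen := fun (i : {i : ℚ × ℚ // 0 < i.1 ∧ i.1 ≤ i.2 ∧ b⁻¹ < ENNReal.ofReal i.1 ∧
      ENNReal.ofReal i.2 < a⁻¹}) (V : countableBasis X) =>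
    isOpen_setOf_forall_exists_smul_pow_mem T (K := {z : 𝕜 | (i.1.1 : ℝ) ≤ ‖z‖ ∧ ‖z‖ ≤ i.1.2})
      ((isCompact_closedBall (0 : 𝕜) i.1.2).of_isClosed_subset
        ((isClosed_le continuous_const continuous_norm).inter
          (isClosed_le continuous_norm continuous_const))
        (fun z hz => by simpa using hz.2))
      (isOpen_of_mem_countableBasis V.2)
  erw [heq]
  refine ⟨dense_iInter_of_isOpen (fun j => hopen j.1 j.2) ?_,
    IsGδ.iInter_of_isOpen fun j => hopen j.1 j.2⟩
  rintro ⟨⟨⟨r₀, r₁⟩, h0, h1, hl, hu⟩, V⟩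
  dsimp only at h0 h1 hl hu ⊢
  have h0' : (0 : ℝ) < r₀ := by exact_mod_cast h0
  have h1' : (r₀ : ℝ) ≤ r₁ := by exact_mod_cast h1
  have h2' : (0 : ℝ) < r₁ := h0'.trans_le h1'
  -- The annulus lies strictly inside the parameter range, which leaves room for `a < α < r₁⁻¹ ≤
  -- r₀⁻¹ < β < b`.
  obtain ⟨α, -, haα, hαr⟩ := ENNReal.lt_iff_exists_real_btwn.1 (ENNReal.lt_inv_iff_lt_inv.1 hu)
  obtain ⟨β, -, hrβ, hβb⟩ := ENNReal.lt_iff_exists_real_btwn.1 (ENNReal.inv_lt_iff_inv_lt.1 hl)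
  have hα0 : 0 < α := ENNReal.ofReal_pos.1 (zero_le.trans_lt haα)
  have hβ0 : 0 < β := ENNReal.ofReal_pos.1 (zero_le.trans_lt hrβ)
  rw [← ENNReal.ofReal_inv_of_pos h2', ENNReal.ofReal_lt_ofReal_iff_of_nonneg hα0.le] at hαr
  rw [← ENNReal.ofReal_inv_of_pos h0', ENNReal.ofReal_lt_ofReal_iff hβ0] at hrβ
  obtain ⟨E, hE, S, hS⟩ := hT α β haα
    (hαr.trans_le ((inv_anti₀ h0' h1').trans hrβ.le)) hβb
  simpa only [mem_ofPred_eq, and_imp] using dense_setOf_forall_exists_smul_pow_mem T hα0 h0' h2' hβ0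
    ((lt_div_iff₀ h2').1 (by rwa [one_div])) ((inv_lt_iff_one_lt_mul₀ h0').1 hrβ)
    E hE S (fun x => (hS x).1) (fun x => (hS x).2.1) (fun x => (hS x).2.2)
    (isOpen_of_mem_countableBasis V.2) (nonempty_of_mem_countableBasis V.2)
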